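/- A Galois structure $\Gamma=(\mathscr C,\mathscr X,I,H,\eta,\epsilon,\mathcal E,\mathcal F)$ consists of an adjunction $I\dashv H$, $I\colon\mathscr C\to\mathscr X$, with unit $\eta\colon 1_{\mathscr C}\Rightarrow HI$ and counit $\epsilon\colon IH\Rightarrow 1_{\mathscr X}$, and of classes $\mathcal E$, $\mathcal F$ of morphisms of $\mathscr C$ and $\mathscr X$ that contain all isomorphisms, are closed under composition and under pullback (pullbacks of their members along arbitrary morphisms exist and belong to the class), and satisfy $I(\mathcal E)\subseteq\mathcal F$ and $H(\mathcal F)\subseteq\mathcal E$. The morphisms in $\mathcal E$ are called extensions; $(\mathscr C\downarrow_{\mathcal E}B)$ and $(\mathscr X\downarrow_{\mathcal F}Y)$ denote the full subcategories of the slice categories $(\mathscr C\downarrow B)$ and $(\mathscr X\downarrow Y)$ determined by $\mathcal E$ and $\mathcal F$. An extension $f\colon A\to B$ is *trivial* if the naturality square of $\eta$ at $f$, i.e. $HI(f)\circ\eta_A=\eta_B\circ f$, is a pullback; *monadic* if the pullback functor $f^*\colon(\mathscr C\downarrow_{\mathcal E}B)\to(\mathscr C\downarrow_{\mathcal E}A)$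 is monadic; and *normal* if it is monadic and the pullback $f^*(f)$ of $f$ along itself is a trivial extension. $\mathrm{Ext}_{\mathcal E}(\mathscr C)$ is the full subcategory of the category of arrows of $\mathscr C$ given by the extensions, and $\mathrm{NExt}_\Gamma(\mathscr C)$ its full subcategory given by the normal extensions. $\Gamma$ is *admissible* if, for every object $B$ of $\mathscr C$, the functor $H^B\colon(\mathscr X\downarrow_{\mathcal F}I(B))\to(\mathscr C\downarrow_{\mathcal E}B)$, which sends $\varphi\colon X\to I(B)$ to the pullback of $H(\varphi)$ along $\eta_B\colon B\to HI(B)$, is fully faithful. Finally, $\Gamma_{\mathrm{Split}}$ is the Galois structure obtained from $\Gamma$ by replacing $\mathcal E$ and $\mathcal F$ by the classes $\mathrm{Split}(\mathcal E)$ and $\mathrm{Split}(\mathcal F)$ of those of their members that are split epimorphisms. **Proposition 3.6.** Let $\Gamma=(\mathscr C,\mathscr X,I,H,\eta,\epsilon,\mathcal E,\mathcal F)$ be a Galois structure such that 1. $I$ preserves every pullback of a morphism $f\colon A\to B$ along a morphism $g\colon C\to B$ for which $f$ is a split epimorphism and both $f$ and $g$ are in $\mathcal E$; 2. $\Gamma_{\mathrm{Split}}$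 is admissible; 3. every extension is monadic. Then the inclusion functor $\mathrm{NExt}_\Gamma(\mathscr C)\to\mathrm{Ext}_{\mathcal E}(\mathscr C)$ admits a left adjoint. -/

import Mathlib

open CategoryTheory CategoryTheory.Limits

universe v₁ v₂ u₁ u₂

/-- The morphisms in the class `P` that are also split epimorphisms. -/
def splitPart {C : Type u₁} [Category.{v₁} C] (P : MorphismProperty C) : MorphismProperty C :=
  fun _ _ f => P f ∧ IsSplitEpi f

/-- A Galois structure `(C, X, I, H, η, ε, E, F)`. As usual, closure of a class under pullback
means that the pullback of a morphism of the class along an arbitrary morphism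
exists and lies in the class. -/
structure GaloisStructure (C : Type u₁) [Category.{v₁} C] (X : Type u₂) [Category.{v₂} X] where
  I : C ⥤ X
  H : X ⥤ C
  /-- the adjunction, with unit `η = adj.unit` and counit `ε = adj.counit` -/
  adj : I ⊣ H
  /-- the class of extensions -/
  E : MorphismProperty C
  F : MorphismProperty X
  E_hasPullbacks : E.HasPullbacks
  E_pullback : E.IsStableUnderBaseChange
  E_comp : E.IsStableUnderComposition
  E_iso : MorphismProperty.isomorphisms C ≤ E
  F_hasPullbacks : F.HasPullbacks
  F_pullback : F.IsStableUnderBaseChange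
  F_comp : F.IsStableUnderComposition
  F_iso : MorphismProperty.isomorphisms X ≤ F
  I_mem : ∀ ⦃A B : C⦄ (f : A ⟶ B), E f → F (I.map f)
  H_mem : ∀ ⦃A B : X⦄ (f : A ⟶ B), F f → E (H.map f)

namespace splitPart

variable {C : Type u₁} [Category.{v₁} C] {P : MorphismProperty C}

theorem hasPullbacks (h : P.HasPullbacks) : (splitPart P).HasPullbacks where
  hasPullback _ hf := h.hasPullback _ hf.1

theorem isStableUnderBaseChange (h : P.IsStableUnderBaseChange) :
    (splitPart P).IsStableUnderBaseChange where
  of_isPullback {_ _ _ _ f g f' g'} sq hg := by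
    refine ⟨h.of_isPullback sq hg.1, ?_⟩
    obtain ⟨⟨s⟩⟩ := hg.2
    exact ⟨⟨⟨sq.lift (f ≫ s.section_) (𝟙 _) (by simp), by simp⟩⟩⟩

theorem isStableUnderComposition (h : P.IsStableUnderComposition) :
    (splitPart P).IsStableUnderComposition where
  comp_mem f g hf hg := by
    refine ⟨h.comp_mem f g hf.1 hg.1, ?_⟩
    obtain ⟨⟨s⟩⟩ := hf.2
    obtain ⟨⟨t⟩⟩ := hg.2
    exact ⟨⟨⟨t.section_ ≫ s.section_, by simp⟩⟩⟩

theorem isomorphisms_le (h : MorphismProperty.isomorphisms C ≤ P) :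
    MorphismProperty.isomorphisms C ≤ splitPart P := by
  intro _ _ f hf
  have : IsIso f := hf
  exact ⟨h f hf, inferInstance⟩

end splitPart

namespace GaloisStructure

attribute [instance] E_hasPullbacks E_pullback E_comp F_hasPullbacks F_pullback F_comp

variable {C : Type u₁} [Category.{v₁} C] {X : Type u₂} [Category.{v₂} X]
variable (Γ : GaloisStructure C X)

/-- The induced Galois structure `Γ_Split` with classes `Split(E)` and `Split(F)`. -/
def split : GaloisStructure C X where
  I := Γ.I
  H := Γ.H
  adj := Γ.adj
  E := splitPart Γ.E
  F := splitPart Γ.F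
  E_hasPullbacks := splitPart.hasPullbacks Γ.E_hasPullbacks
  E_pullback := splitPart.isStableUnderBaseChange Γ.E_pullback
  E_comp := splitPart.isStableUnderComposition Γ.E_comp
  E_iso := splitPart.isomorphisms_le Γ.E_iso
  F_hasPullbacks := splitPart.hasPullbacks Γ.F_hasPullbacks
  F_pullback := splitPart.isStableUnderBaseChange Γ.F_pullback
  F_comp := splitPart.isStableUnderComposition Γ.F_comp
  F_iso := splitPart.isomorphisms_le Γ.F_iso
  I_mem _ _ f hf := by
    have := hf.2
    exact ⟨Γ.I_mem f hf.1, inferInstance⟩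
  H_mem _ _ f hf := by
    have := hf.2
    exact ⟨Γ.H_mem f hf.1, inferInstance⟩

/-- `(C ↓_E B)`: the full subcategory of the slice category over `B` given by the extensions. -/
abbrev ExtOver (B : C) := Γ.E.Over ⊤ B

/-- `(X ↓_F Y)`. -/
abbrev FOver (Y : X) := Γ.F.Over ⊤ Y

/-- The change-of-base functor `p^* : (C ↓_E B) ⥤ (C ↓_E D)` given by pulling back along `p`. -/
noncomputable abbrev changeOfBase {D B : C} (p : D ⟶ B) : Γ.ExtOver B ⥤ Γ.ExtOver D :=
  MorphismProperty.Over.pullback Γ.E ⊤ p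

/-- The functor `(X ↓_F Y) ⥤ (C ↓_E H(Y))` sending `φ` to `H(φ)`. -/
def mapH (Y : X) : Γ.FOver Y ⥤ Γ.ExtOver (Γ.H.obj Y) where
  obj φ := MorphismProperty.Over.mk ⊤ (Γ.H.map φ.hom) (Γ.H_mem φ.hom φ.prop)
  map {φ ψ} g := MorphismProperty.Over.homMk (Γ.H.map g.left)
    ((Γ.H.map_comp _ _).symm.trans (congrArg Γ.H.map (MorphismProperty.Over.w g))) trivial
  map_id φ := by ext; exact Γ.H.map_id _
  map_comp g h := by ext; exact Γ.H.map_comp _ _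

/-- The functor `H^B : (X ↓_F I(B)) ⥤ (C ↓_E B)` sending `φ` to the pullback of `H(φ)` along the
unit `η_B : B ⟶ HI(B)`. -/
noncomputable def HB (B : C) : Γ.FOver (Γ.I.obj B) ⥤ Γ.ExtOver B :=
  Γ.mapH (Γ.I.obj B) ⋙ Γ.changeOfBase (Γ.adj.unit.app B)

/-- `Γ` is admissible when every `H^B` is fully faithful. -/
def IsAdmissible : Prop :=
  ∀ B : C, (Γ.HB B).Full ∧ (Γ.HB B).Faithful

/-- `I` preserves the pullback squares of `f` along `g` for which `f` is a split epimorphism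
and `f` and `g` are extensions. -/
def PreservesSplitPullbacks : Prop :=
  ∀ ⦃D A K B : C⦄ (t : D ⟶ A) (l : D ⟶ K) (f : A ⟶ B) (g : K ⟶ B),
    IsPullback t l f g → IsSplitEpi f → Γ.E f → Γ.E g →
      IsPullback (Γ.I.map t) (Γ.I.map l) (Γ.I.map f) (Γ.I.map g)

/-- Trivial extensions: the naturality square of the unit at `f` is a pullback. -/
def IsTrivial {A B : C} (f : A ⟶ B) : Prop :=
  Γ.E f ∧
    IsPullback (Γ.adj.unit.app A) f (Γ.H.map (Γ.I.map f)) (Γ.adj.unit.app B)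

/-- Monadic extensions: the functor `f^* : (C ↓_E B) ⥤ (C ↓_E A)` is monadic. -/
def IsMonadic {A B : C} (f : A ⟶ B) : Prop :=
  Γ.E f ∧ Nonempty (MonadicRightAdjoint (Γ.changeOfBase f))

/-- `f` is split by `p`: the pullback `p^*(f)` of `f` along `p` is a trivial extension. -/
def IsSplitBy {A D B : C} (f : A ⟶ B) (p : D ⟶ B) : Prop :=
  ∃ (P : C) (q : P ⟶ A) (f' : P ⟶ D), IsPullback q f' f p ∧ Γ.IsTrivial f'

/-- Normal extensions: monadic extensions that are split by themselves. -/
def IsNormal {A B : C} (f : A ⟶ B) : Prop :=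
  Γ.IsMonadic f ∧ Γ.IsSplitBy f f

/-- Extensions, as a property of objects of the arrow category. -/
def extProp : ObjectProperty (Arrow C) := fun f => Γ.E f.hom

/-- Normal extensions, as a property of objects of the arrow category. -/
def normalProp : ObjectProperty (Arrow C) := fun f => Γ.IsNormal f.hom

theorem normalProp_le : Γ.normalProp ≤ Γ.extProp := fun _ h => h.1.1

/-- `Ext_E(C)`: the full subcategory of the arrow category of `C` given by the extensions. -/
abbrev Ext := Γ.extProp.FullSubcategory

/-- `NExt_Γ(C)`: the full subcategory given by the normal extensions. -/
abbrev NExt := Γ.normalProp.FullSubcategory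

/-- The inclusion functor `NExt_Γ(C) ⥤ Ext_E(C)`. -/
def inclusion : Γ.NExt ⥤ Γ.Ext := ObjectProperty.ιOfLE Γ.normalProp_le

end GaloisStructure

/-! Fix an extension `f : A ⟶ B`. Since `f^*` is monadic, extensions of `B` amount to extensions of
`A` with an algebra structure for the monad `f^* f_!`. The pullback `f^*(f)` is a split epimorphism,
so admissibility of `Γ.split` provides an arrow from it to a trivial extension `l` of `A`, and `I`
inverts this arrow (`exists_isTrivial`). Trivial extensions are local for the class `splitInverted`
of such arrows, and the monad preserves this class because `I` preserves pullbacks of split epic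
extensions along extensions. Hence the reflection lifts to algebras
(`exists_reflection_of_monadic`): `f` factors through an extension `g` of `B` with `f^*(g) ≅ l`,
universally among the extensions of `B` split by `f`.

Being split by `f`, which factors through it, `g` is split by itself, by descent
(`isSplitBy_self_of_factors`). Conversely, a normal extension receiving an arrow from `f` becomes
split by `f` once pulled back to `B`. So `f ⟶ g` is universal among arrows to normal extensions
(`exists_isNormal`). -/

namespace GaloisStructure

variable {C : Type u₁} [Category.{v₁} C] {X : Type u₂} [Category.{v₂} X]
variable {Γ : GaloisStructure C X}

/-! ### Admissibility and trivial extensions -/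

/-- The projection from the pullback of `H(φ)` along the unit. -/
noncomputable def HBfst {B : C} (φ : Γ.FOver (Γ.I.obj B)) :
    ((Γ.HB B).obj φ).left ⟶ Γ.H.obj φ.left :=
  pullback.fst ((Γ.mapH (Γ.I.obj B)).obj φ).hom (Γ.adj.unit.app B)

theorem isPullback_HBfst {B : C} (φ : Γ.FOver (Γ.I.obj B)) :
    IsPullback (HBfst φ) ((Γ.HB B).obj φ).hom (Γ.H.map φ.hom) (Γ.adj.unit.app B) :=
  IsPullback.of_hasPullback ((Γ.mapH (Γ.I.obj B)).obj φ).hom (Γ.adj.unit.app B)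

theorem HB_map_left_HBfst {B : C} {φ ψ : Γ.FOver (Γ.I.obj B)} (s : φ ⟶ ψ) :
    ((Γ.HB B).map s).left ≫ HBfst ψ = HBfst φ ≫ Γ.H.map s.left := by
  have : HasPullback (Γ.H.map ψ.hom) (Γ.adj.unit.app B) := (isPullback_HBfst ψ).hasPullback
  exact pullback.lift_fst (f := Γ.H.map ψ.hom) _ _ _

/-- Full faithfulness of `HB`, freed from the chosen pullbacks: any two pullback squares may
represent the objects. -/
theorem IsAdmissible.existsUnique_over (hΓ : Γ.IsAdmissible) {B P Q : C}
    {φ ψ : Γ.FOver (Γ.I.obj B)} {q : P ⟶ Γ.H.obj φ.left} {p : P ⟶ B}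
    (sq : IsPullback q p (Γ.H.map φ.hom) (Γ.adj.unit.app B))
    {q' : Q ⟶ Γ.H.obj ψ.left} {p' : Q ⟶ B}
    (sq' : IsPullback q' p' (Γ.H.map ψ.hom) (Γ.adj.unit.app B)) (u : P ⟶ Q) (hu : u ≫ p' = p) :
    ∃! s : φ ⟶ ψ, q ≫ Γ.H.map s.left = u ≫ q' := by
  obtain ⟨_, _⟩ := hΓ B
  let e : P ≅ ((Γ.HB B).obj φ).left := sq.isoIsPullback _ _ (isPullback_HBfst φ)
  let e' : Q ≅ ((Γ.HB B).obj ψ).left := sq'.isoIsPullback _ _ (isPullback_HBfst ψ)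
  have he₁ : e.hom ≫ HBfst φ = q := sq.isoIsPullback_hom_fst _ _ _
  have he₂ : e.hom ≫ ((Γ.HB B).obj φ).hom = p := sq.isoIsPullback_hom_snd _ _ _
  have he₁' : e'.hom ≫ HBfst ψ = q' := sq'.isoIsPullback_hom_fst _ _ _
  have he₂' : e'.hom ≫ ((Γ.HB B).obj ψ).hom = p' := sq'.isoIsPullback_hom_snd _ _ _
  have hu' : (e.inv ≫ u ≫ e'.hom) ≫ ((Γ.HB B).obj ψ).hom = ((Γ.HB B).obj φ).hom := by
    rw [Category.assoc, Category.assoc, he₂', hu, ← he₂, e.inv_hom_id_assoc]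
  let u' : (Γ.HB B).obj φ ⟶ (Γ.HB B).obj ψ :=
    MorphismProperty.Over.homMk (e.inv ≫ u ≫ e'.hom) hu' trivial
  have hu'_left : u'.left ≫ HBfst ψ = e.inv ≫ u ≫ q' := by
    rw [← he₁']
    exact (Category.assoc _ _ _).trans (congrArg _ (Category.assoc _ _ _))
  have key (s : φ ⟶ ψ) : q ≫ Γ.H.map s.left = u ≫ q' ↔ (Γ.HB B).map s = u' := by
    rw [← he₁, Category.assoc, ← HB_map_left_HBfst, ← Iso.eq_inv_comp, ← hu'_left]
    refine ⟨fun h => ?_, fun h => by rw [h]⟩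
    ext
    exact (isPullback_HBfst ψ).hom_ext h ((MorphismProperty.Over.w ((Γ.HB B).map s)).trans
      (MorphismProperty.Over.w u').symm)
  obtain ⟨s, hs⟩ := (Γ.HB B).map_surjective u'
  exact ⟨s, (key s).2 hs, fun t ht => (Γ.HB B).map_injective (((key t).1 ht).trans hs.symm)⟩

theorem IsAdmissible.existsUnique (hΓ : Γ.IsAdmissible) {B P Q : C} {Y Z : X}
    {φ : Y ⟶ Γ.I.obj B} (hφ : Γ.F φ) {ψ : Z ⟶ Γ.I.obj B} (hψ : Γ.F ψ)
    {q : P ⟶ Γ.H.obj Y} {p : P ⟶ B} (sq : IsPullback q p (Γ.H.map φ) (Γ.adj.unit.app B))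
    {q' : Q ⟶ Γ.H.obj Z} {p' : Q ⟶ B} (sq' : IsPullback q' p' (Γ.H.map ψ) (Γ.adj.unit.app B))
    (u : P ⟶ Q) (hu : u ≫ p' = p) :
    ∃! s : Y ⟶ Z, s ≫ ψ = φ ∧ q ≫ Γ.H.map s = u ≫ q' := by
  obtain ⟨s, hs, h⟩ := hΓ.existsUnique_over (φ := MorphismProperty.Over.mk ⊤ φ hφ)
    (ψ := MorphismProperty.Over.mk ⊤ ψ hψ) sq sq' u hu
  refine ⟨s.left, ⟨MorphismProperty.Over.w s, hs⟩, ?_⟩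
  rintro t ⟨h₁, h₂⟩
  exact congrArg (fun k => k.left) (h (MorphismProperty.Over.homMk t h₁ trivial) h₂)

/-- This says that `I` recovers `Y` from the pullback `P`, as full faithfulness of a right adjoint
makes its counit invertible. -/
theorem isIso_homEquiv_symm_of_isPullback (hΓ : Γ.IsAdmissible) {B P : C} {Y : X}
    {φ : Y ⟶ Γ.I.obj B} (hφ : Γ.F φ) {q : P ⟶ Γ.H.obj Y} {p : P ⟶ B}
    (sq : IsPullback q p (Γ.H.map φ) (Γ.adj.unit.app B)) :
    IsIso ((Γ.adj.homEquiv _ _).symm q) := by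
  have hp : Γ.E p := Γ.E_pullback.of_isPullback sq (Γ.H_mem φ hφ)
  obtain ⟨t, ht⟩ : ∃ t : Γ.I.obj P ⟶ Y, t = (Γ.adj.homEquiv _ _).symm q := ⟨_, rfl⟩
  have htq : Γ.adj.homEquiv _ _ t = q := by rw [ht, Equiv.apply_symm_apply]
  have htq' : Γ.adj.unit.app P ≫ Γ.H.map t = q := by rw [← htq, Adjunction.homEquiv_unit]
  have htφ : t ≫ φ = Γ.I.map p := by
    apply (Γ.adj.homEquiv _ _).injective
    rw [Adjunction.homEquiv_naturality_right, htq, sq.w]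
    simp [Adjunction.homEquiv_unit]
  have := Γ.E_hasPullbacks.hasPullback (Γ.adj.unit.app B) (Γ.H_mem _ (Γ.I_mem p hp))
  have sq' := IsPullback.of_hasPullback (Γ.H.map (Γ.I.map p)) (Γ.adj.unit.app B)
  -- Fullness, applied to the comparison of `P` with the pullback of `HI(p)`, yields the candidate
  -- inverse `s`; faithfulness later gives `s ≫ t = 𝟙`.
  obtain ⟨s, ⟨hs₁, hs₂⟩, -⟩ := hΓ.existsUnique hφ (Γ.I_mem p hp) sq sq'
    (sq'.lift (Γ.adj.unit.app P) p (by simp)) (sq'.lift_snd _ _ _)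
  rw [sq'.lift_fst] at hs₂
  rw [← ht]
  refine ⟨s, ?_, ?_⟩
  · apply (Γ.adj.homEquiv _ _).injective
    rw [Adjunction.homEquiv_naturality_right, htq, hs₂, Adjunction.homEquiv_id]
  · refine (hΓ.existsUnique hφ hφ sq sq (𝟙 P) (by simp)).unique ⟨?_, ?_⟩ ⟨?_, ?_⟩
    · rw [Category.assoc, htφ, hs₁]
    · rw [Functor.map_comp, reassoc_of% hs₂, htq', Category.id_comp]
    · simp
    · simp

theorem isTrivial_of_isPullback (hΓ : Γ.IsAdmissible) {B P : C} {Y : X}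
    {φ : Y ⟶ Γ.I.obj B} (hφ : Γ.F φ) {q : P ⟶ Γ.H.obj Y} {p : P ⟶ B}
    (sq : IsPullback q p (Γ.H.map φ) (Γ.adj.unit.app B)) : Γ.IsTrivial p := by
  refine ⟨Γ.E_pullback.of_isPullback sq (Γ.H_mem φ hφ), ?_⟩
  have := isIso_homEquiv_symm_of_isPullback hΓ hφ sq
  set t := (Γ.adj.homEquiv _ _).symm q with ht
  have hq : Γ.adj.unit.app P ≫ Γ.H.map t = q := by
    rw [← Γ.adj.homEquiv_unit (f := t), ht, Equiv.apply_symm_apply]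
  have htφ : t ≫ φ = Γ.I.map p := by
    apply (Γ.adj.homEquiv _ _).injective
    rw [Adjunction.homEquiv_naturality_right, Equiv.apply_symm_apply, sq.w]
    simp [Adjunction.homEquiv_unit]
  refine sq.of_iso (Iso.refl _) (asIso (Γ.H.map t)).symm (Iso.refl _) (Iso.refl _) ?_ ?_ ?_ ?_
  · simp [← hq]
  · simp
  · simp [← htφ]
  · simp

/-- Every extension has a universal arrow to a trivial extension of the same object. -/
theorem exists_isTrivial (hΓ : Γ.IsAdmissible) {A D : C} (d : D ⟶ A) (hd : Γ.E d) :
    ∃ (L : C) (r : D ⟶ L) (l : L ⟶ A), r ≫ l = d ∧ Γ.IsTrivial l ∧ IsIso (Γ.I.map r) := by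
  have := Γ.E_hasPullbacks.hasPullback (Γ.adj.unit.app A) (Γ.H_mem _ (Γ.I_mem d hd))
  have sq := IsPullback.of_hasPullback (Γ.H.map (Γ.I.map d)) (Γ.adj.unit.app A)
  refine ⟨_, sq.lift (Γ.adj.unit.app D) d (by simp), pullback.snd _ _, sq.lift_snd _ _ _,
    isTrivial_of_isPullback hΓ (Γ.I_mem d hd) sq, ?_⟩
  have := isIso_homEquiv_symm_of_isPullback hΓ (Γ.I_mem d hd) sq
  obtain ⟨r, hr⟩ : ∃ r, r = sq.lift (Γ.adj.unit.app D) d (by simp) := ⟨_, rfl⟩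
  have h : Γ.I.map r ≫ (Γ.adj.homEquiv _ _).symm (pullback.fst _ _) = 𝟙 (Γ.I.obj D) := by
    rw [← Adjunction.homEquiv_naturality_left_symm, hr, sq.lift_fst]
    exact ((Γ.adj.homEquiv _ _).symm_apply_eq).2 (Γ.adj.homEquiv_id D).symm
  exact hr ▸ IsIso.of_isIso_fac_right h

/-- Pasting with the unit square of `g` and cancelling the `H`-image of the pullback of `I(g)` along
`I(b)` exhibits `g'` as a pullback along the unit at `A'`. -/
theorem IsTrivial.of_isPullback (hΓ : Γ.IsAdmissible) {A A' G G' : C} {g : G ⟶ A}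
    (hg : Γ.IsTrivial g) {k : G' ⟶ G} {g' : G' ⟶ A'} {b : A' ⟶ A} (sq : IsPullback k g' g b) :
    Γ.IsTrivial g' := by
  have := Γ.F_hasPullbacks.hasPullback (Γ.I.map b) (Γ.I_mem g hg.1)
  have sq₁ := IsPullback.of_hasPullback (Γ.I.map g) (Γ.I.map b)
  have := Γ.adj.rightAdjoint_preservesLimits
  have sq₂ := sq₁.map Γ.H
  have sq₃ := sq.paste_horiz hg.2
  refine isTrivial_of_isPullback hΓ (Γ.F_pullback.of_isPullback sq₁ (Γ.I_mem g hg.1))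
    (q := sq₂.lift (k ≫ Γ.adj.unit.app G) (g' ≫ Γ.adj.unit.app A') ?_)
    (IsPullback.of_right (t := sq₂) ?_ (sq₂.lift_snd _ _ _))
  · simp [sq.w_assoc]
  · rw [sq₂.lift_fst]
    simpa using sq₃

/-- A map into `G` is a map into `A` with a compatible map into `HI(G)`; by adjunction the latter
cannot distinguish `D` from `D'`. -/
theorem IsTrivial.existsUnique_lift {A G D D' : C} {g : G ⟶ A} (hg : Γ.IsTrivial g)
    (r : D ⟶ D') (hr : IsIso (Γ.I.map r)) (d' : D' ⟶ A) (x : D ⟶ G) (hx : x ≫ g = r ≫ d') :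
    ∃! y : D' ⟶ G, r ≫ y = x ∧ y ≫ g = d' := by
  have key (y : D' ⟶ G) (h : r ≫ y = x) :
      y ≫ Γ.adj.unit.app G = Γ.adj.unit.app D' ≫ Γ.H.map (inv (Γ.I.map r) ≫ Γ.I.map x) := by
    simp [← h]
  have w : Γ.adj.unit.app D' ≫ Γ.H.map (inv (Γ.I.map r) ≫ Γ.I.map x) ≫ Γ.H.map (Γ.I.map g) =
      d' ≫ Γ.adj.unit.app A := by
    rw [← Γ.H.map_comp, Category.assoc, ← Γ.I.map_comp, hx]
    simp
  refine ⟨hg.2.lift _ d' ((Category.assoc _ _ _).trans w), ⟨?_, hg.2.lift_snd _ _ _⟩, ?_⟩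
  · apply hg.2.hom_ext
    · rw [Category.assoc, hg.2.lift_fst, ← Adjunction.unit_naturality_assoc, ← Γ.H.map_comp]
      simp
    · simp [hx]
  · rintro y ⟨h₁, h₂⟩
    apply hg.2.hom_ext
    · rw [hg.2.lift_fst, key y h₁]
    · rw [hg.2.lift_snd, h₂]

theorem IsTrivial.isIso {A G G' : C} {g : G ⟶ A} {g' : G' ⟶ A} (hg : Γ.IsTrivial g)
    (hg' : Γ.IsTrivial g') (r : G ⟶ G') (w : r ≫ g' = g) (hr : IsIso (Γ.I.map r)) : IsIso r := by
  obtain ⟨y, ⟨h₁, h₂⟩, -⟩ := hg.existsUnique_lift r hr g' (𝟙 _) (by simp [w])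
  refine ⟨y, h₁, (hg'.existsUnique_lift r hr g' r rfl).unique ⟨?_, ?_⟩ ⟨?_, ?_⟩⟩
  · simp [reassoc_of% h₁]
  · simp [w, h₂]
  · simp
  · simp

theorem IsTrivial.of_iso {A G G' : C} {g : G ⟶ A} (hg : Γ.IsTrivial g) (e : G' ≅ G) :
    Γ.IsTrivial (e.hom ≫ g) := by
  have sq : IsPullback e.hom (e.hom ≫ g) g (𝟙 A) := IsPullback.of_horiz_isIso ⟨by simp⟩
  refine ⟨Γ.E_pullback.of_isPullback sq hg.1, ?_⟩
  refine hg.2.of_iso e.symm (Γ.H.mapIso (Γ.I.mapIso e.symm)) (Iso.refl _) (Iso.refl _) ?_ ?_ ?_ ?_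
  all_goals simp

end GaloisStructure

/-! ### Lifting reflections along monadic functors -/

/-- If a monad preserves a class `W` of morphisms, then a reflection in `W` of the object
underlying an algebra into the `W`-local objects lifts to algebras. -/
theorem exists_reflection_algebra {C : Type u₁} [Category.{v₁} C] (T : CategoryTheory.Monad C)
    (W : MorphismProperty C) (hW : ∀ ⦃M N : C⦄ (r : M ⟶ N), W r → W (T.map r))
    (M : T.Algebra) {N : C} (r : M.A ⟶ N) (hr : W r) (hN : W.isLocal N) :
    ∃ (N' : T.Algebra) (r' : M ⟶ N') (e : N'.A ≅ N), r'.f ≫ e.hom = r ∧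
      ∀ K : T.Algebra, W.isLocal K.A → Function.Bijective (fun y : N' ⟶ K => r' ≫ y) := by
  have inj {M N K : C} {r : M ⟶ N} (h : W r) (hK : W.isLocal K) {y z : N ⟶ K}
      (h' : r ≫ y = r ≫ z) : y = z := (hK r h).1 h'
  -- The structure map extends `M.a ≫ r` along `T.map r`, which lies in `W`. The algebra laws are
  -- then checked after precomposing with `r` and with `T.map (T.map r)`.
  obtain ⟨a, ha⟩ : ∃ a : T.obj N ⟶ N, T.map r ≫ a = M.a ≫ r := (hN _ (hW r hr)).2 _
  have h_unit : T.η.app N ≫ a = 𝟙 N := by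
    apply inj hr hN
    have h := T.η.naturality r
    simp only [Functor.id_map] at h
    change r ≫ T.η.app N = _ at h
    rw [reassoc_of% h, ha, M.unit_assoc, Category.comp_id]
  have h_assoc : T.μ.app N ≫ a = T.map a ≫ a := by
    apply inj (hW _ (hW r hr)) hN
    have h := T.μ.naturality r
    simp only [Functor.comp_map] at h
    rw [reassoc_of% h, ha, ← Functor.map_comp_assoc, ha, Functor.map_comp_assoc, ha,
      M.assoc_assoc]
  let N' : T.Algebra := { A := N, a := a, unit := h_unit, assoc := h_assoc }
  refine ⟨N', { f := r, h := ha }, Iso.refl _, Category.comp_id _,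
    fun K hK => ⟨fun y z h => ?_, fun x => ?_⟩⟩
  · ext
    exact inj hr hK (congrArg Monad.Algebra.Hom.f h)
  · obtain ⟨y, hy⟩ : ∃ y : N ⟶ K.A, r ≫ y = x.f := (hK r hr).2 x.f
    have hy' : T.map y ≫ K.a = a ≫ y := by
      apply inj (hW r hr) hK
      rw [← Functor.map_comp_assoc, hy, x.h, reassoc_of% ha, hy]
    refine ⟨{ f := y, h := hy' }, ?_⟩
    ext
    exact hy

/-- If a monad coming from a monadic right adjoint `R` preserves a class `W` of morphisms, then a
reflection in `W` of an object `R.obj M` into the `W`-local objects lifts along `R`. -/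
theorem exists_reflection_of_monadic {C : Type u₁} [Category.{v₁} C] {D : Type u₂}
    [Category.{v₂} D] (R : D ⥤ C) [MonadicRightAdjoint R] (W : MorphismProperty C)
    (hW : ∀ ⦃M N : C⦄ (r : M ⟶ N), W r → W (R.map ((monadicLeftAdjoint R).map r)))
    {M : D} {N : C} (r : R.obj M ⟶ N) (hr : W r) (hN : W.isLocal N) :
    ∃ (M' : D) (ρ : M ⟶ M') (e : R.obj M' ≅ N), R.map ρ ≫ e.hom = r ∧
      ∀ K : D, W.isLocal (R.obj K) → Function.Bijective (fun y : M' ⟶ K => ρ ≫ y) := by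
  let T := (monadicAdjunction R).toMonad
  let K₀ : D ⥤ T.Algebra := Monad.comparison (monadicAdjunction R)
  have : K₀.IsEquivalence := inferInstanceAs (Monad.comparison (monadicAdjunction R)).IsEquivalence
  obtain ⟨N', r', e₁, he₁, h₁⟩ := exists_reflection_algebra T W hW (K₀.obj M) r hr hN
  let e : K₀.obj (K₀.objPreimage N') ≅ N' := K₀.objObjPreimageIso N'
  refine ⟨K₀.objPreimage N', K₀.preimage (r' ≫ e.inv), T.forget.mapIso e ≪≫ e₁, ?_, fun K hK => ?_⟩
  · have h : K₀.map (K₀.preimage (r' ≫ e.inv)) ≫ e.hom = r' := by simp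
    have h' : R.map (K₀.preimage (r' ≫ e.inv)) ≫ e.hom.f = r'.f :=
      congrArg Monad.Algebra.Hom.f h
    refine (Category.assoc _ _ _).symm.trans ((congrArg (· ≫ e₁.hom) h').trans he₁)
  · have aux := h₁ (K₀.obj K) hK
    refine ⟨fun y z h => ?_, fun x => ?_⟩
    · apply K₀.map_injective
      rw [← cancel_epi e.inv]
      apply aux.1
      simpa using congrArg K₀.map h
    · obtain ⟨y, hy⟩ := aux.2 (K₀.map x)
      refine ⟨K₀.preimage (e.hom ≫ y), K₀.map_injective ?_⟩
      simpa using hy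

theorem reflectsIsomorphisms_of_monadic {C : Type u₁} [Category.{v₁} C] {D : Type u₂}
    [Category.{v₂} D] (R : D ⥤ C) [MonadicRightAdjoint R] : R.ReflectsIsomorphisms where
  reflects f hf := by
    let K₀ := Monad.comparison (monadicAdjunction R)
    have : IsIso ((monadicAdjunction R).toMonad.forget.map (K₀.map f)) := hf
    have := isIso_of_reflects_iso (K₀.map f) (monadicAdjunction R).toMonad.forget
    exact isIso_of_reflects_iso f K₀

/-! ### The class of split morphisms inverted by `I` -/

namespace GaloisStructure

variable {C : Type u₁} [Category.{v₁} C] {X : Type u₂} [Category.{v₂} X]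
variable {Γ : GaloisStructure C X}

theorem split_isTrivial_iff {A B : C} {f : A ⟶ B} :
    Γ.split.IsTrivial f ↔ Γ.IsTrivial f ∧ IsSplitEpi f :=
  ⟨fun h => ⟨⟨h.1.1, h.2⟩, h.1.2⟩, fun h => ⟨⟨h.1.1, h.2⟩, h.1.2⟩⟩

theorem isSplitEpi_of_isPullback {A A' G G' : C} {g : G ⟶ A} (hg : IsSplitEpi g) {k : G' ⟶ G}
    {g' : G' ⟶ A'} {b : A' ⟶ A} (sq : IsPullback k g' g b) : IsSplitEpi g' :=
  ⟨⟨⟨sq.lift (b ≫ section_ g) (𝟙 _) (by simp), by simp⟩⟩⟩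

theorem isSplitEpi_of_isPullback_self {A B P : C} {f : A ⟶ B} {k p : P ⟶ A}
    (sq : IsPullback k p f f) : IsSplitEpi p :=
  ⟨⟨⟨sq.lift (𝟙 _) (𝟙 _) (by simp), by simp⟩⟩⟩

/-- Both pullbacks are preserved by `I`, so by cancellation `I(r')` is a pullback of the isomorphism
`I(r)`. -/
theorem PreservesSplitPullbacks.isIso_map_of_isPullback (hpres : Γ.PreservesSplitPullbacks)
    {A A' D D' P P' : C} {v : A' ⟶ A} (hv : Γ.E v) {d : D ⟶ A} (hd : Γ.E d) (hds : IsSplitEpi d)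
    {d' : D' ⟶ A} (hd' : Γ.E d') (hds' : IsSplitEpi d') {r : D ⟶ D'} (hr : IsIso (Γ.I.map r))
    (hrd : r ≫ d' = d) {k : P ⟶ D} {p : P ⟶ A'} (sq : IsPullback k p d v)
    {k' : P' ⟶ D'} {p' : P' ⟶ A'} (sq' : IsPullback k' p' d' v) {r' : P ⟶ P'}
    (hp : r' ≫ p' = p) (hk : r' ≫ k' = k ≫ r) : IsIso (Γ.I.map r') := by
  have h := hpres _ _ _ _ sq hds hd hv
  have h' := hpres _ _ _ _ sq' hds' hd' hv
  rw [← hrd, ← hp, Functor.map_comp, Functor.map_comp] at h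
  have h₂ := IsPullback.of_bot h (by rw [← Functor.map_comp, ← Functor.map_comp, hk]) h'
  exact (MorphismProperty.isomorphisms X).of_isPullback h₂ hr

/-- The morphisms between split epic extensions of `A` that are inverted by `I`. -/
def splitInverted (Γ : GaloisStructure C X) (A : C) : MorphismProperty (Γ.ExtOver A) :=
  fun d d' r => IsSplitEpi d.hom ∧ IsSplitEpi d'.hom ∧ IsIso (Γ.I.map r.left)

theorem isSplitEpi_hom_of_hom {A : C} {d d' : Γ.ExtOver A} (e : d ⟶ d') (h : IsSplitEpi d.hom) :
    IsSplitEpi d'.hom :=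
  ⟨⟨⟨section_ d.hom ≫ e.left, by
    rw [Category.assoc, MorphismProperty.Over.w]; exact IsSplitEpi.id d.hom⟩⟩⟩

/-- Needed because the left adjoint supplied by monadicity is only isomorphic to composition with
`f`. -/
instance (A : C) : (Γ.splitInverted A).RespectsIso :=
  MorphismProperty.RespectsIso.of_respects_arrow_iso _ (by
    rintro ⟨d₁, d₂, r⟩ ⟨d₁', d₂', r'⟩ e ⟨h₁, h₂, h₃⟩
    refine ⟨isSplitEpi_hom_of_hom e.hom.left h₁, isSplitEpi_hom_of_hom e.hom.right h₂, ?_⟩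
    let G : Γ.ExtOver A ⥤ X :=
      MorphismProperty.Over.forget Γ.E ⊤ A ⋙ CategoryTheory.Over.forget A ⋙ Γ.I
    exact ((MorphismProperty.isomorphisms X).arrow_mk_iso_iff (G.mapArrow.mapIso e)).1 h₃)

theorem IsTrivial.isLocal {A : C} {g : Γ.ExtOver A} (hg : Γ.IsTrivial g.hom) :
    (Γ.splitInverted A).isLocal g := by
  rintro d d' r ⟨-, -, hr⟩
  refine ⟨fun y z h => ?_, fun x => ?_⟩
  · ext
    have h' : r.left ≫ y.left = r.left ≫ z.left := congrArg (fun k => k.left) h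
    exact (hg.existsUnique_lift r.left hr d'.hom (r.left ≫ z.left)
      ((Category.assoc _ _ _).trans (congrArg _ (MorphismProperty.Over.w z)))).unique
        ⟨h', MorphismProperty.Over.w y⟩ ⟨rfl, MorphismProperty.Over.w z⟩
  · obtain ⟨y, ⟨h₁, h₂⟩, -⟩ := hg.existsUnique_lift r.left hr d'.hom x.left
      ((MorphismProperty.Over.w x).trans (MorphismProperty.Over.w r).symm)
    refine ⟨MorphismProperty.Over.homMk y h₂ trivial, ?_⟩
    ext
    exact h₁

/-- The projection from the base change of an extension. -/
noncomputable def baseChangeFst {A B : C} (f : A ⟶ B) (d : Γ.ExtOver B) :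
    ((Γ.changeOfBase f).obj d).left ⟶ d.left :=
  pullback.fst d.hom f

theorem isPullback_baseChangeFst {A B : C} (f : A ⟶ B) (d : Γ.ExtOver B) :
    IsPullback (baseChangeFst f d) ((Γ.changeOfBase f).obj d).hom d.hom f :=
  IsPullback.of_hasPullback d.hom f

theorem changeOfBase_map_left_fst {A B : C} (f : A ⟶ B) {d d' : Γ.ExtOver B} (r : d ⟶ d') :
    ((Γ.changeOfBase f).map r).left ≫ baseChangeFst f d' = baseChangeFst f d ≫ r.left :=
  pullback.lift_fst (f := d'.hom) (g := f) _ _ _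

/-- With the kernel pair of `f`, `f^* f_!` is pullback along the first projection followed by
composition with the second. The second is split by the diagonal, so split epimorphisms are
preserved; the first is an extension, so `I` preserves the pullbacks involved. -/
theorem splitInverted_changeOfBase_map (hpres : Γ.PreservesSplitPullbacks) {A B : C} {f : A ⟶ B}
    (hf : Γ.E f) {d d' : Γ.ExtOver A} {r : d ⟶ d'} (hr : Γ.splitInverted A r) :
    Γ.splitInverted A
      ((Γ.changeOfBase f).map ((MorphismProperty.Over.map (P := Γ.E) ⊤ hf).map r)) := by
  obtain ⟨h₁, h₂, h₃⟩ := hr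
  have := Γ.E_hasPullbacks.hasPullback f hf
  have sq := IsPullback.of_hasPullback f f
  have hfst : Γ.E (pullback.fst f f) := Γ.E_pullback.of_isPullback sq.flip hf
  let F₀ := MorphismProperty.Over.map (P := Γ.E) ⊤ hf
  let T := F₀ ⋙ Γ.changeOfBase f
  let j (x : Γ.ExtOver A) : (T.obj x).left ⟶ x.left := baseChangeFst f (F₀.obj x)
  have sqj (x : Γ.ExtOver A) : IsPullback (j x) (T.obj x).hom (x.hom ≫ f) f :=
    isPullback_baseChangeFst f (F₀.obj x)
  have hj : (T.map r).left ≫ j d' = j d ≫ r.left := changeOfBase_map_left_fst f (F₀.map r)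
  let k (x : Γ.ExtOver A) : (T.obj x).left ⟶ pullback f f :=
    pullback.lift (j x ≫ x.hom) (T.obj x).hom ((Category.assoc _ _ _).trans (sqj x).w)
  have hk₁ (x) : k x ≫ pullback.fst f f = j x ≫ x.hom := pullback.lift_fst _ _ _
  have hk₂ (x) : k x ≫ pullback.snd f f = (T.obj x).hom := pullback.lift_snd _ _ _
  have sqk (x : Γ.ExtOver A) : IsPullback (j x) (k x) x.hom (pullback.fst f f) :=
    IsPullback.of_bot (by rw [hk₂]; exact sqj x) (hk₁ x).symm sq
  have hs (x : Γ.ExtOver A) (hx : IsSplitEpi x.hom) : IsSplitEpi (T.obj x).hom := by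
    have h₁ := isSplitEpi_of_isPullback hx (sqk x)
    have h₂ := isSplitEpi_of_isPullback_self sq
    rw [← hk₂]
    infer_instance
  refine ⟨hs d h₁, hs d' h₂, hpres.isIso_map_of_isPullback hfst d.prop h₁ d'.prop h₂ h₃
    (MorphismProperty.Over.w r) (sqk d) (sqk d') ?_ hj⟩
  apply pullback.hom_ext
  · rw [Category.assoc, hk₁, hk₁, ← MorphismProperty.Over.w r, ← Category.assoc, ← Category.assoc]
    exact congrArg (· ≫ d'.hom) hj
  · rw [Category.assoc, hk₂, hk₂]
    exact MorphismProperty.Over.w (T.map r)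

theorem splitInverted_monad_map (hpres : Γ.PreservesSplitPullbacks) {A B : C} {f : A ⟶ B}
    (hf : Γ.E f) [MonadicRightAdjoint (Γ.changeOfBase f)] {d d' : Γ.ExtOver A} {r : d ⟶ d'}
    (hr : Γ.splitInverted A r) :
    Γ.splitInverted A
      ((Γ.changeOfBase f).map ((monadicLeftAdjoint (Γ.changeOfBase f)).map r)) := by
  let e := (monadicAdjunction (Γ.changeOfBase f)).leftAdjointUniq
    (MorphismProperty.Over.mapPullbackAdj Γ.E ⊤ f hf trivial)
  refine ((Γ.splitInverted A).arrow_mk_iso_iff ?_).2 (splitInverted_changeOfBase_map hpres hf hr)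
  exact (Γ.changeOfBase f).mapArrow.mapIso (Arrow.isoMk' _ _ (e.app d) (e.app d')
    (e.hom.naturality r).symm)

/-! ### Normality and the universal normal extension -/

/-- An extension that is split by an extension factoring through it is split by itself. -/
theorem isSplitBy_self_of_factors (hpres : Γ.PreservesSplitPullbacks)
    (hadm : Γ.split.IsAdmissible) (hmon : ∀ ⦃A B : C⦄ (f : A ⟶ B), Γ.E f → Γ.IsMonadic f)
    {A G B P : C} {f : A ⟶ B} (hf : Γ.E f) {g : G ⟶ B} (hg : Γ.E g) {ρ : A ⟶ G} (hρ : ρ ≫ g = f)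
    {v : P ⟶ G} {p : P ⟶ A} (sq : IsPullback v p g f) (hp : Γ.IsTrivial p) :
    Γ.IsSplitBy g g := by
  -- The factorization `ρ` induces a section of `p`, so stability of trivial extensions under
  -- pullback for `Γ.split` applies to `p`.
  have hps : Γ.split.IsTrivial p := split_isTrivial_iff.2
    ⟨hp, ⟨⟨⟨sq.lift ρ (𝟙 _) (by simp [hρ]), by simp⟩⟩⟩⟩
  have hv : Γ.E v := Γ.E_pullback.of_isPullback sq.flip hf
  obtain ⟨_, ⟨_⟩⟩ := hmon v hv
  have := Γ.E_hasPullbacks.hasPullback g hg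
  have sqg := IsPullback.of_hasPullback g g
  obtain ⟨R, q, π, sqg⟩ : ∃ (R : C) (q π : R ⟶ G), IsPullback q π g g := ⟨_, _, _, sqg⟩
  have hπ : Γ.E π := Γ.E_pullback.of_isPullback sqg hg
  have hπs := isSplitEpi_of_isPullback_self sqg
  obtain ⟨L, r, l, hrl, hl, hr⟩ := exists_isTrivial hadm π ⟨hπ, hπs⟩
  let π' : Γ.ExtOver G := MorphismProperty.Over.mk ⊤ π hπ
  let l' : Γ.ExtOver G := MorphismProperty.Over.mk ⊤ l hl.1.1
  let r' : π' ⟶ l' := MorphismProperty.Over.homMk r hrl trivial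
  -- As `v ≫ g = p ≫ f`, the pullback of `π` along `v` is also the pullback of `p` along itself.
  have h₁ : Γ.split.IsTrivial ((Γ.changeOfBase v).obj π').hom := by
    have sq₁ := (isPullback_baseChangeFst v π').paste_horiz sqg
    rw [sq.w] at sq₁
    exact hps.of_isPullback hadm
      (IsPullback.of_right (h₁₁ := sq.lift _ _ (sq₁.w.trans (Category.assoc _ _ _).symm))
        (by simpa using sq₁) (sq.lift_snd _ _ _) sq)
  have h₂ : Γ.split.IsTrivial ((Γ.changeOfBase v).obj l').hom :=
    hl.of_isPullback hadm (isPullback_baseChangeFst v l')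
  have h₃ : IsIso (Γ.I.map ((Γ.changeOfBase v).map r').left) :=
    hpres.isIso_map_of_isPullback hv hπ hπs hl.1.1 hl.1.2 hr hrl (isPullback_baseChangeFst v π')
      (isPullback_baseChangeFst v l') (MorphismProperty.Over.w _) (changeOfBase_map_left_fst v r')
  have h₄ : IsIso ((Γ.changeOfBase v).map r').left :=
    h₁.isIso h₂ _ (MorphismProperty.Over.w _) h₃
  let U (A : C) : Γ.ExtOver A ⥤ C :=
    MorphismProperty.Over.forget Γ.E ⊤ A ⋙ CategoryTheory.Over.forget A
  have h₅ : IsIso ((Γ.changeOfBase v).map r') := by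
    have : IsIso ((U P).map ((Γ.changeOfBase v).map r')) := h₄
    exact isIso_of_reflects_iso _ (U P)
  -- Descent: `v` is an extension, so `v^*` is monadic and hence conservative. Thus `π` agrees with
  -- its trivialization `l`.
  have := reflectsIsomorphisms_of_monadic (Γ.changeOfBase v)
  have h₆ : IsIso r' := isIso_of_reflects_iso r' (Γ.changeOfBase v)
  have : IsIso r := inferInstanceAs (IsIso ((U G).map r'))
  refine ⟨R, q, π, sqg, ?_⟩
  rw [← hrl]
  exact (split_isTrivial_iff.1 hl).1.of_iso (asIso r)

/-- Every extension has a universal arrow to a normal extension. -/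
theorem exists_isNormal (hpres : Γ.PreservesSplitPullbacks)
    (hadm : Γ.split.IsAdmissible) (hmon : ∀ ⦃A B : C⦄ (f : A ⟶ B), Γ.E f → Γ.IsMonadic f)
    {A B : C} (f : A ⟶ B) (hf : Γ.E f) :
    ∃ (G : C) (g : G ⟶ B) (ρ : A ⟶ G), ρ ≫ g = f ∧ Γ.IsNormal g ∧
      ∀ ⦃A' B' : C⦄ (h : A' ⟶ B') (a : A ⟶ A') (b : B ⟶ B'), Γ.IsNormal h → a ≫ h = f ≫ b →
        ∃! y : G ⟶ A', ρ ≫ y = a ∧ y ≫ h = g ≫ b := by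
  obtain ⟨_, ⟨_⟩⟩ := hmon f hf
  let M : Γ.ExtOver B := MorphismProperty.Over.mk ⊤ f hf
  let π := (Γ.changeOfBase f).obj M
  have hπs : IsSplitEpi π.hom := isSplitEpi_of_isPullback_self (isPullback_baseChangeFst f M)
  obtain ⟨L, r, l, hrl, hl, hr⟩ := exists_isTrivial hadm π.hom ⟨π.prop, hπs⟩
  let N : Γ.ExtOver A := MorphismProperty.Over.mk ⊤ l hl.1.1
  have hN : Γ.IsTrivial N.hom := (split_isTrivial_iff.1 hl).1
  obtain ⟨M', ρ, e, -, huniv⟩ := exists_reflection_of_monadic (Γ.changeOfBase f)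
    (Γ.splitInverted A) (fun _ _ _ h => splitInverted_monad_map hpres hf h)
    (MorphismProperty.Over.homMk r hrl trivial : π ⟶ N) ⟨hπs, hl.1.2, hr⟩ hN.isLocal
  have hρ : ρ.left ≫ M'.hom = f := MorphismProperty.Over.w ρ
  have htriv : Γ.IsTrivial ((Γ.changeOfBase f).obj M').hom := by
    let e' : ((Γ.changeOfBase f).obj M').left ≅ N.left :=
      (MorphismProperty.Over.forget Γ.E ⊤ A ⋙ CategoryTheory.Over.forget A).mapIso e
    have : e'.hom ≫ N.hom = ((Γ.changeOfBase f).obj M').hom := MorphismProperty.Over.w e.hom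
    exact this ▸ hN.of_iso e'
  refine ⟨M'.left, M'.hom, ρ.left, hρ, ⟨hmon _ M'.prop, isSplitBy_self_of_factors hpres hadm hmon hf
    M'.prop hρ (isPullback_baseChangeFst f M') htriv⟩, fun A' B' h a b hh w => ?_⟩
  obtain ⟨⟨hE, -⟩, P, q, p, sq, hp⟩ := hh
  have := Γ.E_hasPullbacks.hasPullback b hE
  obtain ⟨K, k, c, sqk⟩ : ∃ (K : C) (k : K ⟶ A') (c : K ⟶ B), IsPullback k c h b :=
    ⟨_, _, _, IsPullback.of_hasPullback h b⟩
  let c' : Γ.ExtOver B := MorphismProperty.Over.mk ⊤ c (Γ.E_pullback.of_isPullback sqk hE)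
  -- As `a ≫ h = f ≫ b`, the pullback of `c` along `f` is the pullback along `a` of the trivial
  -- extension `p = h^*(h)`.
  have hc : Γ.IsTrivial ((Γ.changeOfBase f).obj c').hom := by
    have sq₁ := (isPullback_baseChangeFst f c').paste_horiz sqk
    rw [← w] at sq₁
    exact ((split_isTrivial_iff.2 ⟨hp, isSplitEpi_of_isPullback_self sq⟩).of_isPullback hadm
      (IsPullback.of_right (h₁₁ := sq.lift _ _ (sq₁.w.trans (Category.assoc _ _ _).symm))
        (by simpa using sq₁) (sq.lift_snd _ _ _) sq) |> split_isTrivial_iff.1).1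
  have bij := huniv c' hc.isLocal
  -- Arrows to `h` over `b` correspond to arrows to `c'` over `B`, where the universal property of
  -- `M'` applies.
  have key (y : M'.left ⟶ A') (h₁ : ρ.left ≫ y = a) (h₂ : y ≫ h = M'.hom ≫ b) :
      ∃ z : M' ⟶ c', z.left ≫ k = y ∧
        ρ ≫ z = MorphismProperty.Over.homMk (sqk.lift a f w) (sqk.lift_snd _ _ _) trivial := by
    refine ⟨MorphismProperty.Over.homMk (sqk.lift y M'.hom h₂) (sqk.lift_snd _ _ _) trivial,
      sqk.lift_fst _ _ _, ?_⟩
    ext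
    apply sqk.hom_ext
    · refine (Category.assoc _ _ _).trans ?_
      exact (congrArg _ (sqk.lift_fst _ _ _)).trans (h₁.trans (sqk.lift_fst _ _ _).symm)
    · refine (Category.assoc _ _ _).trans ?_
      exact (congrArg _ (sqk.lift_snd _ _ _)).trans (hρ.trans (sqk.lift_snd _ _ _).symm)
  obtain ⟨z, hz⟩ := bij.2
    (MorphismProperty.Over.homMk (sqk.lift a f w) (sqk.lift_snd _ _ _) trivial)
  have hz' : ρ.left ≫ z.left = sqk.lift a f w := congrArg (fun k => k.left) hz
  have hz'' : z.left ≫ c = M'.hom := MorphismProperty.Over.w z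
  refine ⟨z.left ≫ k, ⟨?_, ?_⟩, ?_⟩
  · exact (Category.assoc _ _ _).symm.trans ((congrArg (· ≫ k) hz').trans (sqk.lift_fst _ _ _))
  · exact (Category.assoc _ _ _).trans ((congrArg _ sqk.w).trans
      ((Category.assoc _ _ _).symm.trans (congrArg (· ≫ b) hz'')))
  · rintro y ⟨h₁, h₂⟩
    obtain ⟨z', hz₁, hz₂⟩ := key y h₁ h₂
    rw [← hz₁, bij.1 (hz₂.trans hz.symm)]

end GaloisStructure

/-! ### The left adjoint -/

theorem proposition3p6 {C : Type u₁} [Category.{v₁} C] {X : Type u₂} [Category.{v₂} X]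
    (Γ : GaloisStructure C X)
    (hpres : Γ.PreservesSplitPullbacks)
    (hadm : Γ.split.IsAdmissible)
    (hmon : ∀ ⦃A B : C⦄ (f : A ⟶ B), Γ.E f → Γ.IsMonadic f) :
    Γ.inclusion.IsRightAdjoint := by
  have (f : Γ.Ext) : HasInitial (StructuredArrow f Γ.inclusion) := by
    obtain ⟨G, g, ρ, hρ, hg, huniv⟩ :=
      GaloisStructure.exists_isNormal hpres hadm hmon f.obj.hom f.property
    let g' : Γ.NExt := ⟨Arrow.mk g, hg⟩
    -- The universal arrow is the identity on codomains, which forces the codomain component of any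
    -- arrow out of `S`.
    let S : StructuredArrow f Γ.inclusion :=
      StructuredArrow.mk (Y := g')
        (ObjectProperty.homMk (Arrow.homMk ρ (𝟙 _) (hρ.trans (Category.comp_id _).symm)))
    have key (s : StructuredArrow f Γ.inclusion) :=
      huniv s.right.obj.hom s.hom.hom.left s.hom.hom.right s.right.property s.hom.hom.w
    choose y hy hy' using key
    refine (IsInitial.ofUniqueHom (X := S)
      (fun s => StructuredArrow.homMk
        (ObjectProperty.homMk (Arrow.homMk (y s) s.hom.hom.right (hy s).2)) ?_)
      (fun s m => ?_)).hasInitial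
    · ext
      · exact (hy s).1
      · exact Category.id_comp _
    · have hm := congrArg (fun k => k.hom) (StructuredArrow.w m)
      have hr : m.right.hom.right = s.hom.hom.right :=
        (Category.id_comp _).symm.trans (congrArg (fun k => k.right) hm)
      ext
      · refine hy' s m.right.hom.left ⟨congrArg (fun k => k.left) hm, ?_⟩
        exact m.right.hom.w.trans (congrArg (g ≫ ·) hr)
      · exact hr
  exact isRightAdjointOfStructuredArrowInitials _
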